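/- **Theorem (decomposition theorem).** *Setting.* A $C^2$-unimodal map is a $C^2$ map $f:[a,b]\to[a,b]$ with a point $C\in(a,b)$ such that $f$ is strictly increasing on $[a,C)$ and strictly decreasing on $(C,b]$. A $q$-supercycle of $f$ is the orbit $O_q=\{C,f(C),\dots,f^{q-1}(C)\}$ when $C$ is periodic with least period $q\ge 1$. Write its points in descending order as $C_{(1,q)}>\dots>C_{(q,q)}$. The next visiting permutation $\beta_q=(\beta(1,q),\dots,\beta(q,q))$ of $O_q$ is defined by $f(C_{(i,q)})=C_{(\beta(i,q),q)}$. If $q=hs$, the boxes are $H_j=\{(j-1)s+k : 1\le k\le s\}$ for $1\le j\le h$, and $\beta^j(k,q)=\beta((j-1)s+k,q)$. Let $O_h$ and $O_s$ be supercycles of (possibly different) $C^2$-unimodal maps, with next visiting permutations $\beta_h$ and $\beta_s$, and let $\beta(c,h)=1$. An $hs$-supercycle $O_{hs}$ of a $C^2$-unimodal map $f$ is the composition of $O_h$ and $O_s$ if (i) for each $i$, $f$ maps the points of $O_{hs}$ with positions in $H_i$ to points with positions in $H_{\beta(i,h)}$; and (ii) on the central box $H_c$ the map $f^h$ permutes the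 $s$ points according to $\beta_s$ if $f^h$ has a local maximum at the critical point, that is, $f^h(C_{((c-1)s+k,hs)})=C_{((c-1)s+\beta(k,s),hs)}$ for $1\le k\le s$, and according to the conjugate permutation $\overline{\beta}_s(k)=s+1-\beta(s+1-k,s)$ in the same sense if $f^h$ has a local minimum there. *Statement.* Let $O_q$ be a supercycle of a $C^2$-unimodal map with next visiting permutation $\beta_q$, let $\beta(z,q)=1$, let $q=hs$ with $h,s\in\mathbb N$, and put $m=\left[\frac{z-1}{s}\right]$ (integer part), so that $z\in H_{m+1}$. Then $O_q$ is the composition of some $h$-supercycle $O_h$ and some $s$-supercycle $O_s$ if and only if there is a next visiting permutation $\beta_s=(\beta(1,s),\dots,\beta(s,s))$ of some $s$-supercycle of a $C^2$-unimodal map such that, for all $k=1,\dots,s$: a) $\beta^i(k,q)=\beta^i(1,q)-(k-1)$ for $i=1,\dots,m$; b) $\beta^i(k,q)=\beta^i(1,q)+(k-1)$ for $i=m+2,\dots,h$; c) $\beta^{m+1}(k,q)=\beta(k,s)$ if $m+1$ is odd, and $\beta^{m+1}(k,q)=\beta(s+1-k,s)$ if $m+1$ is even. -/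

import Mathlib

open Set

/-- `f` maps `[a, b]` to itself, is of class `C²` there, strictly increasing to the left of the
interior point `C` and strictly decreasing to the right of it (so `C` is the maximum). -/
structure IsC2Unimodal (f : ℝ → ℝ) (a b C : ℝ) : Prop where
  left_lt : a < C
  lt_right : C < b
  mapsTo : MapsTo f (Icc a b) (Icc a b)
  contDiffOn : ContDiffOn ℝ 2 f (Icc a b)
  strictMonoOn : StrictMonoOn f (Ico a C)
  strictAntiOn : StrictAntiOn f (Ioc C b)

/-- A `q`-periodic supercycle: a `C²`-unimodal map whose critical point `C` is periodic with
least period `q ≥ 1`. -/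
structure Supercycle (q : ℕ) where
  f : ℝ → ℝ
  a : ℝ
  b : ℝ
  C : ℝ
  unimodal : IsC2Unimodal f a b C
  pos : 0 < q
  period : Function.minimalPeriod f C = q

namespace Supercycle

variable {q : ℕ}

/-- The points `C, f(C), …, f^{q-1}(C)` of the orbit. -/
noncomputable def points (O : Supercycle q) : Finset ℝ :=
  (Finset.range q).image (fun j => O.f^[j] O.C)

/-- `x` is the `i`-th point of the orbit in descending order (`i = 1` is the largest point):
it belongs to the orbit and exactly `i` points of the orbit are `≥ x`. -/
def IsOrdPoint (O : Supercycle q) (i : ℕ) (x : ℝ) : Prop :=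
  x ∈ O.points ∧ (O.points.filter (fun y => x ≤ y)).card = i

/-- `β` is the next visiting permutation of the orbit: `f` sends the `i`-th point to the
`β i`-th point. This determines `β` on `{1, …, q}`; values outside are irrelevant. -/
def IsNextVisitingPerm (O : Supercycle q) (β : ℕ → ℕ) : Prop :=
  ∀ i x, O.IsOrdPoint i x → O.IsOrdPoint (β i) (O.f x)

end Supercycle

/-- The `j`-th box of size `s`: `{(j-1)s + k : k = 1, …, s}`. -/
def box (s j : ℕ) : Finset ℕ :=
  (Finset.Icc 1 s).image (fun k => (j - 1) * s + k)

/-- The conjugated permutation of a permutation `γ` of `{1, …, n}`. -/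
def conjPerm (n : ℕ) (γ : ℕ → ℕ) (i : ℕ) : ℕ := n + 1 - γ (n + 1 - i)

/-- `O` is the composition of `Oh` and `Os`: the `h` points of `Oh` are replaced by `h` boxes of
`s` consecutive points each, the boxes are visited according to `βh`, and at each return (after
`h` steps) to the central box `H_c`, `βh c = 1`, its points are visited according to `βs` if
`f^h` has a maximum at `C`, and according to the conjugate of `βs` if it has a minimum at `C`. -/
def IsComposition {q h s : ℕ} (O : Supercycle q) (Oh : Supercycle h) (Os : Supercycle s) : Prop :=
  q = h * s ∧
  ∃ βh βs : ℕ → ℕ, Oh.IsNextVisitingPerm βh ∧ Os.IsNextVisitingPerm βs ∧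
    (∀ i ∈ Finset.Icc 1 h, ∀ p ∈ box s i, ∀ x, O.IsOrdPoint p x →
      ∃ p' ∈ box s (βh i), O.IsOrdPoint p' (O.f x)) ∧
    (∀ c ∈ Finset.Icc 1 h, βh c = 1 →
      (IsLocalMax (O.f^[h]) O.C → ∀ k ∈ Finset.Icc 1 s, ∀ x,
        O.IsOrdPoint ((c - 1) * s + k) x →
          O.IsOrdPoint ((c - 1) * s + βs k) (O.f^[h] x)) ∧
      (IsLocalMin (O.f^[h]) O.C → ∀ k ∈ Finset.Icc 1 s, ∀ x,
        O.IsOrdPoint ((c - 1) * s + k) x →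
          O.IsOrdPoint ((c - 1) * s + conjPerm s βs k) (O.f^[h] x)))

/-- `β^j(r) = β((j-1)s + r)`: the `r`-th entry of the `j`-th block of length `s` of `β`. -/
def blockEntry (s : ℕ) (β : ℕ → ℕ) (j r : ℕ) : ℕ := β ((j - 1) * s + r)

/-!
Counted from `0` in descending order, the positions of a supercycle are permuted by a single cycle
which decreases up to the position `z` of the critical point and increases from there on
(`IsUnimodalCycle`, `Supercycle.IsDescending.isUnimodalCycle`). Composition and the block conditions
on `β` are both rephrased through one notion, `MapsBoxes`: every box of `s` consecutive positions is
mapped into a box. A composition has this property by definition. Under the block conditions the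
image of each box is a run of `s` consecutive positions, the turning box being sent onto the first
`s` positions; disjoint runs of length `s` that tile an interval are boxes (`mapsBoxes_of_runs`).

Once boxes are mapped to boxes, monotonicity does the rest. With `m` the index (from `0`) of the
turning box, a monotone bijection between boxes reverses the order on the `m` boxes before it and
is a translation on those after it. The map induced on the boxes is again a unimodal cycle
(`MapsBoxes.isUnimodalCycle`), so it visits each of these boxes exactly once before it returns.
Hence the first return to the turning box is the first step `β^{m+1}`, followed by the reversal
exactly when `m` is odd (`MapsBoxes.first_return`). The same count of reversals shows that `C` is a
strict local maximum of `f^h` if `m` is even and a strict local minimum if `m` is odd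
(`Supercycle.IsDescending.eventually_first_return`), so that the two extremum cases in the
definition of composition exclude each other and match the two parities.

It remains to find a supercycle with the cycle of boxes as its next visiting permutation. Every
unimodal cycle is realized by a smooth map that interpolates it at integers, with strictly monotone
flat-ended steps between them (`smoothInterp`, `IsUnimodalCycle.exists_supercycle`).
-/

/-! ### Unimodal cycles -/

/-- `σ` acts on `{0, …, q - 1}` as a single cycle of length `q`, and is unimodal in the orientation
of descending positions: decreasing up to `z` and increasing from `z` on. This is a next visiting
permutation with positions counted from `0`, and `z` the position of the critical point. -/
structure IsUnimodalCycle (q : ℕ) (σ : ℕ → ℕ) (z : ℕ) : Prop where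
  lt : z < q
  mapsTo : ∀ p < q, σ p < q
  anti : StrictAntiOn σ (Iic z)
  mono : StrictMonoOn σ (Ico z q)
  period : Function.minimalPeriod σ z = q

namespace IsUnimodalCycle

variable {q : ℕ} {σ : ℕ → ℕ} {z : ℕ}

theorem iterate_lt (hσ : IsUnimodalCycle q σ z) {p : ℕ} (hp : p < q) (j : ℕ) :
    σ^[j] p < q := by
  induction j with
  | zero => exact hp
  | succ j ih => rw [Function.iterate_succ_apply']; exact hσ.mapsTo _ ih

theorem exists_iterate (hσ : IsUnimodalCycle q σ z) {p : ℕ} (hp : p < q) :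
    ∃ j < q, σ^[j] z = p := by
  have hinj : InjOn (fun j => σ^[j] z) (Finset.range q : Set ℕ) := by
    have h := Function.iterate_injOn_Iio_minimalPeriod (f := σ) (x := z)
    rw [hσ.period] at h
    intro a ha b hb
    exact h (by simpa using ha) (by simpa using hb)
  have hmaps : MapsTo (fun j => σ^[j] z) (Finset.range q : Set ℕ) (Finset.range q : Set ℕ) := by
    intro j _
    simpa using hσ.iterate_lt hσ.lt j
  obtain ⟨j, hj, h⟩ := Finset.surjOn_of_injOn_of_card_le _ hmaps hinj le_rfl
    (show p ∈ (Finset.range q : Set ℕ) by simpa using hp)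
  exact ⟨j, by simpa using hj, h⟩

theorem iterate_period (hσ : IsUnimodalCycle q σ z) {p : ℕ} (hp : p < q) : σ^[q] p = p := by
  obtain ⟨j, -, rfl⟩ := hσ.exists_iterate hp
  rw [← Function.iterate_add_apply, Nat.add_comm, Function.iterate_add_apply]
  congr 1
  have h := Function.isPeriodicPt_minimalPeriod σ z
  rw [hσ.period] at h
  exact h

theorem injOn (hσ : IsUnimodalCycle q σ z) : InjOn σ (Iio q) := by
  obtain ⟨n, hn⟩ := Nat.exists_eq_succ_of_ne_zero (Nat.ne_zero_of_lt hσ.lt)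
  intro p hp p' hp' h
  rw [← hσ.iterate_period hp, ← hσ.iterate_period hp', hn, Function.iterate_succ_apply,
    Function.iterate_succ_apply, h]

theorem exists_preimage (hσ : IsUnimodalCycle q σ z) {v : ℕ} (hv : v < q) :
    ∃ p < q, σ p = v := by
  obtain ⟨n, hn⟩ := Nat.exists_eq_succ_of_ne_zero (Nat.ne_zero_of_lt hσ.lt)
  refine ⟨σ^[n] v, hσ.iterate_lt hv n, ?_⟩
  rw [← Function.iterate_succ_apply' σ, ← hn]
  exact hσ.iterate_period hv

theorem apply_top (hσ : IsUnimodalCycle q σ z) : σ z = 0 := by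
  have hz := hσ.lt
  obtain ⟨p, hp, h0⟩ := hσ.exists_preimage (show 0 < q by omega)
  rcases lt_trichotomy p z with h | h | h
  · have := hσ.anti (show p ∈ Iic z from h.le) (show z ∈ Iic z from le_refl z) h
    omega
  · rw [← h, h0]
  · have := hσ.mono (show z ∈ Ico z q from ⟨le_rfl, hz⟩) (show p ∈ Ico z q from ⟨h.le, hp⟩) h
    omega

end IsUnimodalCycle

/-! ### Monotone maps between boxes -/

theorem eq_self_of_strictMonoOn {s : ℕ} {g : ℕ → ℕ} (hmaps : ∀ k < s, g k < s)
    (hg : StrictMonoOn g (Iio s)) {k : ℕ} (hk : k < s) : g k = k := by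
  have hle : ∀ k, k < s → k ≤ g k := by
    intro k
    induction k with
    | zero => intro _; exact Nat.zero_le _
    | succ k ih =>
      intro hk
      have h1 := ih (by omega)
      have h2 := hg (show k ∈ Iio s from by simp; omega) (show k + 1 ∈ Iio s from hk)
        (Nat.lt_succ_self k)
      omega
  have hge : ∀ d k, k + d + 1 = s → g k ≤ k := by
    intro d
    induction d with
    | zero => intro k hk; have := hmaps k (by omega); omega
    | succ d ih =>
      intro k hk
      have h1 := ih (k + 1) (by omega)
      have h2 := hg (show k ∈ Iio s from by simp; omega)
        (show k + 1 ∈ Iio s from by simp; omega) (Nat.lt_succ_self k)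
      omega
  have h1 := hle k hk
  have h2 := hge (s - 1 - k) k (by omega)
  omega

theorem eq_rev_of_strictAntiOn {s : ℕ} {g : ℕ → ℕ} (hmaps : ∀ k < s, g k < s)
    (hg : StrictAntiOn g (Iio s)) {k : ℕ} (hk : k < s) : g k = s - 1 - k := by
  have h := eq_self_of_strictMonoOn (g := fun k => s - 1 - g k) (s := s)
    (by intro k hk; omega)
    (by
      intro a ha b hb hab
      have h1 := hg ha hb hab
      have h2 := hmaps a ha
      dsimp only; omega) hk
  have h2 := hmaps k hk
  omega

/-! ### Cycles that permute boxes -/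

/-- `σ` maps each of the `h` boxes `{i * s, …, i * s + s - 1}` into the box with index `τ i`. -/
def MapsBoxes (h s : ℕ) (σ τ : ℕ → ℕ) : Prop :=
  ∀ p < h * s, σ p / s = τ (p / s)

section Boxes

variable {h s z : ℕ} {σ τ : ℕ → ℕ}

theorem mul_add_lt_mul {i k : ℕ} (hi : i < h) (hk : k < s) : i * s + k < h * s := by
  calc i * s + k < i * s + s := by omega
    _ = (i + 1) * s := by ring
    _ ≤ h * s := Nat.mul_le_mul_right _ hi

theorem mul_add_div {i k : ℕ} (hk : k < s) : (i * s + k) / s = i := by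
  rw [Nat.mul_comm, Nat.mul_add_div (by omega), Nat.div_eq_of_lt hk, Nat.add_zero]

theorem eq_mul_add_of_div_eq {v i : ℕ} (hs : 0 < s) (hv : v / s = i) :
    v = i * s + (v - i * s) ∧ v - i * s < s := by
  subst hv
  have h1 := Nat.div_add_mod v s
  have h2 := Nat.mod_lt v hs
  rw [Nat.mul_comm] at h1
  omega

theorem MapsBoxes.iterate_div (hb : MapsBoxes h s σ τ) (hσ : IsUnimodalCycle (h * s) σ z)
    {p : ℕ} (hp : p < h * s) (j : ℕ) : σ^[j] p / s = τ^[j] (p / s) := by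
  induction j with
  | zero => rfl
  | succ j ih =>
    rw [Function.iterate_succ_apply', Function.iterate_succ_apply', hb _ (hσ.iterate_lt hp j), ih]

/-- The cycle of boxes inherits unimodality and transitivity from the cycle of points. -/
theorem MapsBoxes.isUnimodalCycle (hb : MapsBoxes h s σ τ) (hσ : IsUnimodalCycle (h * s) σ z) :
    IsUnimodalCycle h τ (z / s) := by
  have hz := hσ.lt
  have hs : 0 < s := Nat.pos_of_ne_zero (by rintro rfl; simp at hz)
  have hzh : z / s < h := Nat.div_lt_of_lt_mul (by rwa [Nat.mul_comm])
  have hmaps : ∀ i < h, τ i < h := by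
    intro i hi
    have hp := mul_add_lt_mul hi hs
    have h1 := hb _ hp
    rw [mul_add_div hs] at h1
    rw [← h1]
    exact Nat.div_lt_of_lt_mul (Nat.mul_comm h s ▸ hσ.mapsTo _ hp)
  have hper : Function.minimalPeriod τ (z / s) = h := by
    have hpt : Function.IsPeriodicPt τ (h * s) (z / s) := by
      change τ^[h * s] (z / s) = z / s
      rw [← hb.iterate_div hσ hz, hσ.iterate_period hz]
    have hpos := hpt.minimalPeriod_pos (by omega)
    apply le_antisymm
    · have h1 : (Finset.range (Function.minimalPeriod τ (z / s))).card ≤ (Finset.range h).card := by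
        apply Finset.card_le_card_of_injOn (fun j => τ^[j] (z / s))
        · intro j _
          have h2 := hb.iterate_div hσ hz j
          have h3 := hσ.iterate_lt hz j
          simp only [Finset.coe_range, mem_Iio]
          rw [← h2]
          exact Nat.div_lt_of_lt_mul (by rwa [Nat.mul_comm])
        · intro a ha b hb
          exact Function.iterate_injOn_Iio_minimalPeriod (by simpa using ha) (by simpa using hb)
      simpa using h1
    · have h1 : (Finset.range h).card ≤ (Finset.range (Function.minimalPeriod τ (z / s))).card := by
        apply Finset.card_le_card_of_surjOn (fun j => τ^[j] (z / s))
        intro i hi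
        have hi : i < h := by simpa using hi
        obtain ⟨j, -, hj⟩ := hσ.exists_iterate (mul_add_lt_mul hi hs)
        refine ⟨j % Function.minimalPeriod τ (z / s), by simpa using Nat.mod_lt _ hpos, ?_⟩
        dsimp only
        rw [Function.iterate_mod_minimalPeriod_eq, ← hb.iterate_div hσ hz, hj, mul_add_div hs]
      simpa using h1
  have hinj : ∀ i < h, ∀ j < h, τ i = τ j → i = j := by
    -- `τ` permutes a finite set, being onto it along the orbit of `z / s`
    have hsurj : SurjOn τ (Finset.range h : Set ℕ) (Finset.range h : Set ℕ) := by
      intro i hi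
      have hi : i < h := by simpa using hi
      obtain ⟨p, hp, hpi⟩ := hσ.exists_preimage (mul_add_lt_mul hi hs)
      refine ⟨p / s, ?_, ?_⟩
      · simpa using Nat.div_lt_of_lt_mul (by rwa [Nat.mul_comm])
      · rw [← hb p hp, hpi, mul_add_div hs]
    have h2 := Finset.injOn_of_surjOn_of_card_le τ
      (by intro i hi; simpa using hmaps i (by simpa using hi)) hsurj le_rfl
    intro i hi j hj hij
    exact h2 (by simpa using hi) (by simpa using hj) hij
  have hzs := Nat.div_mul_le_self z s
  have hzs' := Nat.lt_div_mul_add (a := z) hs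
  refine ⟨hzh, hmaps, ?_, ?_, hper⟩
  · intro i hi j hj hij
    have hi : i ≤ z / s := hi
    have hj : j ≤ z / s := hj
    refine lt_of_le_of_ne ?_ (fun e => hij.ne (hinj _ (by omega) _ (by omega) e.symm))
    have hjz : j * s ≤ z := (Nat.mul_le_mul_right _ hj).trans hzs
    have hijs : i * s < j * s := Nat.mul_lt_mul_of_pos_right hij hs
    have h1 := hσ.anti (show i * s ∈ Iic z by simp; omega) (show j * s ∈ Iic z by simpa) hijs
    have h2 := hb (i * s) (by omega)
    have h3 := hb (j * s) (by omega)
    rw [Nat.mul_div_cancel _ hs] at h2 h3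
    rw [← h2, ← h3]
    exact Nat.div_le_div_right h1.le
  · intro i hi j hj hij
    refine lt_of_le_of_ne ?_ (fun e => hij.ne (hinj _ hi.2 _ hj.2 e))
    have hk : s - 1 < s := by omega
    have hzi : z ≤ i * s + (s - 1) := by
      have := Nat.mul_le_mul_right s hi.1
      omega
    have hijs : i * s < j * s := Nat.mul_lt_mul_of_pos_right hij hs
    have hiq := mul_add_lt_mul hi.2 hk
    have hjq := mul_add_lt_mul hj.2 hk
    have h1 := hσ.mono (show i * s + (s - 1) ∈ Ico z (h * s) from ⟨hzi, hiq⟩)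
      (show j * s + (s - 1) ∈ Ico z (h * s) from ⟨by omega, hjq⟩) (by omega)
    have h2 := hb _ hiq
    have h3 := hb _ hjq
    rw [mul_add_div hk] at h2 h3
    rw [← h2, ← h3]
    exact Nat.div_le_div_right h1.le

theorem MapsBoxes.apply_sub_lt (hb : MapsBoxes h s σ τ) {i k : ℕ} (hi : i < h) (hk : k < s) :
    σ (i * s + k) = τ i * s + (σ (i * s + k) - τ i * s) ∧ σ (i * s + k) - τ i * s < s := by
  apply eq_mul_add_of_div_eq (by omega)
  rw [hb _ (mul_add_lt_mul hi hk), mul_add_div hk]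

/-- A box to the left of the turning box is reversed, since `σ` is decreasing there. -/
theorem MapsBoxes.apply_of_lt (hb : MapsBoxes h s σ τ) (hσ : IsUnimodalCycle (h * s) σ z)
    {i k : ℕ} (hi : i < z / s) (hk : k < s) : σ (i * s + k) = τ i * s + (s - 1 - k) := by
  have hz := hσ.lt
  have hs : 0 < s := by omega
  have hzh : z / s < h := Nat.div_lt_of_lt_mul (by rwa [Nat.mul_comm])
  have hzs := Nat.div_mul_le_self z s
  have h1 := eq_rev_of_strictAntiOn (g := fun k => σ (i * s + k) - τ i * s)
    (fun k hk => (hb.apply_sub_lt (by omega) hk).2) (by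
      intro a ha b hb' hab
      have hbz := mul_add_lt_mul hi (show b < s from hb')
      have h2 := hσ.anti (show i * s + a ∈ Iic z by simp; omega)
        (show i * s + b ∈ Iic z by simp; omega) (by omega)
      have h3 := hb.apply_sub_lt (i := i) (by omega) (show a < s from ha)
      have h4 := hb.apply_sub_lt (i := i) (by omega) (show b < s from hb')
      dsimp only
      omega) hk
  have h2 := hb.apply_sub_lt (i := i) (by omega) hk
  omega

/-- A box to the right of the turning box is translated, since `σ` is increasing there. -/
theorem MapsBoxes.apply_of_gt (hb : MapsBoxes h s σ τ) (hσ : IsUnimodalCycle (h * s) σ z)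
    {i k : ℕ} (hi : z / s < i) (hih : i < h) (hk : k < s) : σ (i * s + k) = τ i * s + k := by
  have hs : 0 < s := by omega
  have hzs' := Nat.lt_div_mul_add (a := z) hs
  have hzi : z < i * s := by
    have := Nat.mul_le_mul_right s hi
    rw [Nat.succ_mul] at this
    omega
  have h1 := eq_self_of_strictMonoOn (g := fun k => σ (i * s + k) - τ i * s)
    (fun k hk => (hb.apply_sub_lt hih hk).2) (by
      intro a ha b hb' hab
      have h2 := hσ.mono (show i * s + a ∈ Ico z (h * s) from ⟨by omega, mul_add_lt_mul hih ha⟩)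
        (show i * s + b ∈ Ico z (h * s) from ⟨by omega, mul_add_lt_mul hih hb'⟩) (by omega)
      have h3 := hb.apply_sub_lt hih (show a < s from ha)
      have h4 := hb.apply_sub_lt hih (show b < s from hb')
      dsimp only
      omega) hk
  have h2 := hb.apply_sub_lt hih hk
  omega

/-- The number of indices `1 ≤ i ≤ j` for which the `i`-th image of `m` under `τ` is below `m`:
the number of orientation reversals along a piece of orbit that starts at the turning box. -/
def reversals (τ : ℕ → ℕ) (m j : ℕ) : ℕ :=
  ((Finset.range j).filter (fun i => τ^[i + 1] m < m)).card

theorem reversals_zero (τ : ℕ → ℕ) (m : ℕ) : reversals τ m 0 = 0 := rfl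

theorem reversals_succ (τ : ℕ → ℕ) (m j : ℕ) :
    reversals τ m (j + 1) = reversals τ m j + if τ^[j + 1] m < m then 1 else 0 := by
  unfold reversals
  rw [Finset.range_add_one, Finset.filter_insert]
  split_ifs
  · rw [Finset.card_insert_of_notMem (fun hj => Finset.notMem_range_self (Finset.mem_filter.1 hj).1)]
  · rfl

theorem IsUnimodalCycle.iterate_ne {q m : ℕ} (hτ : IsUnimodalCycle q τ m) {j : ℕ}
    (hj : j + 1 < q) : τ^[j + 1] m ≠ m :=
  fun e => Function.not_isPeriodicPt_of_pos_of_lt_minimalPeriod (Nat.succ_ne_zero j)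
    (by rw [hτ.period]; exact hj) e

/-- On a full turn of the cycle, every index below `m` is met exactly once. -/
theorem IsUnimodalCycle.reversals_eq {q m : ℕ} (hτ : IsUnimodalCycle q τ m) :
    reversals τ m (q - 1) = m := by
  have hm := hτ.lt
  have hc : ((Finset.range (q - 1)).filter (fun i => τ^[i + 1] m < m)).card
      = (Finset.range m).card := by
    apply Finset.card_bij (fun i _ => τ^[i + 1] m)
    · intro i hi
      simpa using (Finset.mem_filter.1 hi).2
    · intro a ha b hb hab
      have ha := Finset.mem_range.1 (Finset.mem_filter.1 ha).1
      have hb := Finset.mem_range.1 (Finset.mem_filter.1 hb).1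
      have := Function.iterate_injOn_Iio_minimalPeriod (f := τ) (x := m)
        (show a + 1 ∈ Iio _ by rw [hτ.period]; simp; omega)
        (show b + 1 ∈ Iio _ by rw [hτ.period]; simp; omega) hab
      omega
    · intro v hv
      have hv := Finset.mem_range.1 hv
      obtain ⟨j, hj, rfl⟩ := hτ.exists_iterate (show v < q by omega)
      obtain _ | j := j
      · exact absurd hv (lt_irrefl _)
      · exact ⟨j, by simp only [Finset.mem_filter, Finset.mem_range]; exact ⟨by omega, hv⟩, rfl⟩
  rw [reversals, hc, Finset.card_range]

/-- After its first step, the first return to the turning box is a composition of `z / s` reversals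
and of translations. -/
theorem MapsBoxes.first_return (hb : MapsBoxes h s σ τ) (hσ : IsUnimodalCycle (h * s) σ z)
    {k : ℕ} (hk : k < s) :
    σ (z / s * s + k) < s ∧ σ^[h] (z / s * s + k) =
      z / s * s + if Even (z / s) then σ (z / s * s + k) else s - 1 - σ (z / s * s + k) := by
  have hτ := hb.isUnimodalCycle hσ
  have hm := hτ.lt
  have hpos : 0 < h := Nat.zero_lt_of_lt hm
  have h0 := hb.apply_sub_lt hm hk
  rw [hτ.apply_top] at h0
  have hw : σ (z / s * s + k) < s := by simpa using h0.2
  refine ⟨hw, ?_⟩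
  have key : ∀ j, j < h → σ^[j + 1] (z / s * s + k) = τ^[j + 1] (z / s) * s +
      if Even (reversals τ (z / s) j) then σ (z / s * s + k) else s - 1 - σ (z / s * s + k) := by
    intro j
    induction j with
    | zero =>
      intro _
      simp [reversals_zero, hτ.apply_top]
    | succ j ih =>
      intro hj
      rw [Function.iterate_succ_apply', ih (by omega), Function.iterate_succ_apply' τ (j + 1),
        reversals_succ]
      have hlt := hτ.iterate_lt hm (j + 1)
      have hl : (if Even (reversals τ (z / s) j) then σ (z / s * s + k)
          else s - 1 - σ (z / s * s + k)) < s := by split_ifs <;> omega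
      rcases lt_or_gt_of_ne (hτ.iterate_ne hj) with hc | hc
      · rw [hb.apply_of_lt hσ hc hl, if_pos hc]
        simp only [Nat.even_add_one]
        split_ifs <;> omega
      · rw [hb.apply_of_gt hσ hc hlt hl, if_neg hc.not_gt]
        rfl
  have := key (h - 1) (by omega)
  rwa [show h - 1 + 1 = h by omega, hτ.iterate_period hm, hτ.reversals_eq] at this

/-- If the image of each box is a run of `s` consecutive positions and that of one box is
`{0, …, s - 1}`, then the runs, being disjoint, are boxes. -/
theorem mapsBoxes_of_runs {r : ℕ → ℕ} (hσ : IsUnimodalCycle (h * s) σ z)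
    (hr : ∀ i < h, ∀ v, (∃ k < s, σ (i * s + k) = v) ↔ r i ≤ v ∧ v < r i + s) :
    MapsBoxes h s σ (fun i => r i / s) := by
  have hz := hσ.lt
  have hs : 0 < s := Nat.pos_of_ne_zero (by rintro rfl; simp at hz)
  have hdisj : ∀ i < h, ∀ j < h, ∀ v, r i ≤ v → v < r i + s → r j ≤ v → v < r j + s → i = j := by
    intro i hi j hj v h1 h2 h3 h4
    obtain ⟨k, hk, hkv⟩ := (hr i hi v).2 ⟨h1, h2⟩
    obtain ⟨l, hl, hlv⟩ := (hr j hj v).2 ⟨h3, h4⟩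
    have := hσ.injOn (mul_add_lt_mul hi hk) (mul_add_lt_mul hj hl) (hkv.trans hlv.symm)
    rw [← mul_add_div (i := i) hk, this, mul_add_div hl]
  have hcover : ∀ v < h * s, ∃ i < h, r i ≤ v ∧ v < r i + s := by
    intro v hv
    obtain ⟨p, hp, hpv⟩ := hσ.exists_preimage hv
    have hph : p / s < h := Nat.div_lt_of_lt_mul (by rwa [Nat.mul_comm])
    refine ⟨p / s, hph, (hr _ hph v).1 ⟨p % s, Nat.mod_lt _ hs, ?_⟩⟩
    rw [Nat.mul_comm, Nat.div_add_mod, hpv]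
  have hstart : ∀ j < h, ∃ i < h, r i = j * s := by
    intro j
    induction j with
    | zero =>
      intro hj
      obtain ⟨i, hi, h1, -⟩ := hcover 0 (by omega)
      exact ⟨i, hi, by omega⟩
    | succ j ih =>
      intro hj
      obtain ⟨i', hi', hri'⟩ := ih (by omega)
      obtain ⟨i, hi, h1, h2⟩ := hcover ((j + 1) * s) (Nat.mul_lt_mul_of_pos_right hj hs)
      refine ⟨i, hi, ?_⟩
      by_contra hne
      -- otherwise the run through `(j + 1) * s` also meets the run that fills the previous box
      have hexp : (j + 1) * s = j * s + s := by ring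
      have := hdisj i hi i' hi' ((j + 1) * s - 1) (by omega) (by omega) (by omega) (by omega)
      subst this
      omega
  intro p hp
  have hph : p / s < h := Nat.div_lt_of_lt_mul (by rwa [Nat.mul_comm])
  have hpp : p / s * s + p % s = p := by rw [Nat.mul_comm, Nat.div_add_mod]
  have hv := (hr _ hph (σ p)).1 ⟨p % s, Nat.mod_lt _ hs, by rw [hpp]⟩
  have hrq : r (p / s) < h * s := by
    obtain ⟨k, hk, e⟩ := (hr _ hph (r (p / s))).2 ⟨le_rfl, by omega⟩
    rw [← e]
    exact hσ.mapsTo _ (mul_add_lt_mul hph hk)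
  have hrh : r (p / s) / s < h := Nat.div_lt_of_lt_mul (by rwa [Nat.mul_comm])
  obtain ⟨i, hi, hri⟩ := hstart _ hrh
  have h1 := Nat.div_mul_le_self (r (p / s)) s
  have h2 := Nat.lt_div_mul_add (a := r (p / s)) hs
  have := hdisj i hi _ hph (r (p / s)) (by omega) (by omega) le_rfl (by omega)
  subst this
  dsimp only
  rw [show σ p = r (p / s) / s * s + (σ p - r (p / s)) by omega, mul_add_div (by omega)]

end Boxes

/-! ### Smooth interpolation -/

theorem smoothTransition_lt {t u : ℝ} (h0 : 0 ≤ t) (h1 : t < 1) (htu : t < u) :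
    Real.smoothTransition t < Real.smoothTransition u := by
  have e1 : expNegInvGlue t < expNegInvGlue u := by
    rcases h0.eq_or_lt with rfl | h
    · rw [expNegInvGlue.zero]; exact expNegInvGlue.pos_of_pos htu
    · rw [expNegInvGlue, expNegInvGlue, if_neg h.not_ge, if_neg (h.trans htu).not_ge]
      exact Real.exp_lt_exp.2 (neg_lt_neg ((inv_lt_inv₀ (h.trans htu) h).2 htu))
  have e2 : expNegInvGlue (1 - u) ≤ expNegInvGlue (1 - t) := expNegInvGlue.monotone (by linarith)
  have e3 : 0 < expNegInvGlue (1 - t) := expNegInvGlue.pos_of_pos (by linarith)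
  have e4 := expNegInvGlue.nonneg t
  unfold Real.smoothTransition
  rw [div_lt_div_iff₀ (Real.smoothTransition.pos_denom t) (Real.smoothTransition.pos_denom u)]
  nlinarith [mul_le_mul_of_nonneg_left e2 e4, mul_lt_mul_of_pos_right e1 e3]

/-- The smooth function that takes the values `y 0, …, y N` at `0, …, N` and is flat there, each
step from `y n` to `y (n + 1)` being a rescaled `Real.smoothTransition`. -/
noncomputable def smoothInterp (N : ℕ) (y : ℕ → ℝ) (x : ℝ) : ℝ :=
  y 0 + ∑ n ∈ Finset.range N, (y (n + 1) - y n) * Real.smoothTransition (x - n)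

theorem contDiff_smoothInterp (N : ℕ) (y : ℕ → ℝ) : ContDiff ℝ 2 (smoothInterp N y) := by
  unfold smoothInterp
  refine contDiff_const.add (ContDiff.sum fun n _ => contDiff_const.mul ?_)
  exact (Real.smoothTransition.contDiff (n := 2)).comp (contDiff_id.sub contDiff_const)

theorem smoothInterp_natCast {N : ℕ} (y : ℕ → ℝ) {n : ℕ} (hn : n ≤ N) :
    smoothInterp N y n = y n := by
  have h : ∑ i ∈ Finset.range N, (y (i + 1) - y i) * Real.smoothTransition ((n : ℝ) - i)
      = ∑ i ∈ Finset.range n, (y (i + 1) - y i) := by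
    symm
    apply Finset.sum_subset_zero_on_sdiff
      (Finset.range_subset_range.2 hn)
    · intro i hi
      simp only [Finset.mem_sdiff, Finset.mem_range] at hi
      have : (n : ℝ) ≤ i := by exact_mod_cast (show n ≤ i by omega)
      rw [Real.smoothTransition.zero_of_nonpos (by linarith), mul_zero]
    · intro i hi
      have : (i : ℝ) + 1 ≤ n := by exact_mod_cast (Finset.mem_range.1 hi)
      rw [Real.smoothTransition.one_of_one_le (by linarith), mul_one]
  rw [smoothInterp, h, Finset.sum_range_sub]
  ring

theorem strictMonoOn_smoothInterp {N m : ℕ} {y : ℕ → ℝ} (hm : m ≤ N)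
    (hy : ∀ n < m, y n < y (n + 1)) : StrictMonoOn (smoothInterp N y) (Icc 0 m) := by
  intro u hu v hv huv
  have hum : u < m := huv.trans_le hv.2
  have hf : ⌊u⌋₊ < m := (Nat.floor_lt hu.1).2 hum
  have hf1 := Nat.floor_le hu.1
  have hf2 := Nat.lt_floor_add_one u
  refine add_lt_add_right (Finset.sum_lt_sum (fun n _ => ?_) ⟨⌊u⌋₊, ?_, ?_⟩) _
  · rcases lt_or_ge n m with hn | hn
    · exact mul_le_mul_of_nonneg_left (Real.smoothTransition.monotone (by linarith))
        (by linarith [hy n hn])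
    · have : (m : ℝ) ≤ n := by exact_mod_cast hn
      rw [Real.smoothTransition.zero_of_nonpos (by linarith),
        Real.smoothTransition.zero_of_nonpos (by linarith [hv.2])]
  · exact Finset.mem_range.2 (hf.trans_le hm)
  · exact mul_lt_mul_of_pos_left (smoothTransition_lt (by linarith) (by linarith) (by linarith))
      (by linarith [hy _ hf])

theorem strictAntiOn_smoothInterp {N m : ℕ} {y : ℕ → ℝ}
    (hy : ∀ n, m ≤ n → n < N → y (n + 1) < y n) :
    StrictAntiOn (smoothInterp N y) (Icc m N) := by
  intro u hu v hv huv
  have hu0 : 0 ≤ u := (Nat.cast_nonneg m).trans hu.1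
  have hf : ⌊u⌋₊ < N := (Nat.floor_lt hu0).2 (huv.trans_le hv.2)
  have hfm : m ≤ ⌊u⌋₊ := Nat.le_floor hu.1
  have hf1 := Nat.floor_le hu0
  have hf2 := Nat.lt_floor_add_one u
  refine add_lt_add_right (Finset.sum_lt_sum (fun n hn => ?_) ⟨⌊u⌋₊, ?_, ?_⟩) _
  · rcases lt_or_ge n m with hnm | hnm
    · have : (n : ℝ) + 1 ≤ m := by exact_mod_cast hnm
      rw [Real.smoothTransition.one_of_one_le (by linarith [hu.1]),
        Real.smoothTransition.one_of_one_le (by linarith [hu.1])]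
    · exact mul_le_mul_of_nonpos_left (Real.smoothTransition.monotone (by linarith))
        (by linarith [hy n hnm (Finset.mem_range.1 hn)])
  · exact Finset.mem_range.2 hf
  · exact mul_lt_mul_of_neg_left (smoothTransition_lt (by linarith) (by linarith) (by linarith))
      (by linarith [hy _ hfm hf])

/-! ### Supercycles and their descending enumerations -/

/-- `X 0 > X 1 > … > X (q - 1)` are the points of the orbit. -/
def Supercycle.IsDescending {q : ℕ} (O : Supercycle q) (X : ℕ → ℝ) : Prop :=
  StrictAntiOn X (Iio q) ∧ O.points = (Finset.range q).image X

namespace Supercycle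

variable {q : ℕ} {O : Supercycle q} {X : ℕ → ℝ}

theorem card_points (O : Supercycle q) : O.points.card = q := by
  rw [points, Finset.card_image_of_injOn, Finset.card_range]
  intro a ha b hb
  have h := Function.iterate_injOn_Iio_minimalPeriod (f := O.f) (x := O.C)
  rw [O.period] at h
  exact fun e => h (by simpa using ha) (by simpa using hb) e

theorem exists_isDescending (O : Supercycle q) : ∃ X, O.IsDescending X := by
  let e := O.points.orderEmbOfFin O.card_points
  refine ⟨fun p => if hp : p < q then e (Fin.rev ⟨p, hp⟩) else 0, ?_, ?_⟩
  · intro a ha b hb hab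
    have ha : a < q := ha
    have hb : b < q := hb
    dsimp only
    rw [dif_pos ha, dif_pos hb]
    exact e.strictMono (Fin.rev_lt_rev.2 (by simpa using hab))
  · ext x
    have h := Set.ext_iff.1 (O.points.range_orderEmbOfFin O.card_points) x
    rw [Finset.mem_coe] at h
    rw [← h]
    simp only [Finset.mem_image, Finset.mem_range, mem_range]
    constructor
    · rintro ⟨i, rfl⟩
      refine ⟨(Fin.rev i).1, (Fin.rev i).2, ?_⟩
      rw [dif_pos (Fin.rev i).2]
      exact congrArg e (Fin.rev_rev i)
    · rintro ⟨p, hp, rfl⟩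
      exact ⟨Fin.rev ⟨p, hp⟩, by rw [dif_pos hp]⟩

theorem IsDescending.isOrdPoint (hX : O.IsDescending X) {p : ℕ} (hp : p < q) :
    O.IsOrdPoint (p + 1) (X p) := by
  refine ⟨by rw [hX.2]; exact Finset.mem_image_of_mem _ (Finset.mem_range.2 hp), ?_⟩
  have h : O.points.filter (fun y => X p ≤ y) = (Finset.range (p + 1)).image X := by
    ext y
    simp only [hX.2, Finset.mem_filter, Finset.mem_image, Finset.mem_range]
    constructor
    · rintro ⟨⟨i, hi, rfl⟩, hle⟩
      exact ⟨i, Nat.lt_succ_of_le ((hX.1.le_iff_ge hp hi).1 hle), rfl⟩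
    · rintro ⟨i, hi, rfl⟩
      have hiq : i < q := by omega
      exact ⟨⟨i, hiq, rfl⟩, (hX.1.le_iff_ge hp hiq).2 (by omega)⟩
  rw [h, Finset.card_image_of_injOn, Finset.card_range]
  intro a ha b hb
  have ha : a < p + 1 := by simpa using ha
  have hb : b < p + 1 := by simpa using hb
  exact hX.1.injOn (show a < q by omega) (show b < q by omega)

theorem IsDescending.isOrdPoint_iff (hX : O.IsDescending X) {i : ℕ} {x : ℝ} :
    O.IsOrdPoint i x ↔ ∃ p < q, i = p + 1 ∧ x = X p := by
  constructor
  · intro h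
    have h1 := h.1
    rw [hX.2] at h1
    obtain ⟨p, hp, rfl⟩ := Finset.mem_image.1 h1
    have hp := Finset.mem_range.1 hp
    exact ⟨p, hp, h.2.symm.trans (hX.isOrdPoint hp).2, rfl⟩
  · rintro ⟨p, hp, rfl, rfl⟩
    exact hX.isOrdPoint hp

/-- In a descending enumeration, a next visiting permutation is the map `f` itself. -/
theorem IsDescending.apply (hX : O.IsDescending X) {β : ℕ → ℕ} (hβ : O.IsNextVisitingPerm β)
    {p : ℕ} (hp : p < q) :
    β (p + 1) = (β (p + 1) - 1) + 1 ∧ β (p + 1) - 1 < q ∧ O.f (X p) = X (β (p + 1) - 1) := by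
  obtain ⟨p', hp', h1, h2⟩ := hX.isOrdPoint_iff.1 (hβ _ _ (hX.isOrdPoint hp))
  rw [h1]
  simpa using ⟨hp', h2⟩

theorem IsDescending.isNextVisitingPerm (hX : O.IsDescending X) {σ : ℕ → ℕ}
    (hσ : ∀ p < q, σ p < q) (hf : ∀ p < q, O.f (X p) = X (σ p)) :
    O.IsNextVisitingPerm (fun i => σ (i - 1) + 1) := by
  intro i x hx
  obtain ⟨p, hp, rfl, rfl⟩ := hX.isOrdPoint_iff.1 hx
  rw [hf p hp]
  exact hX.isOrdPoint (hσ p hp)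

end Supercycle

theorem iterate_eq_of_semiconj_lt {q : ℕ} {σ : ℕ → ℕ} {f : ℝ → ℝ} {X : ℕ → ℝ}
    (hσ : ∀ p < q, σ p < q) (hf : ∀ p < q, f (X p) = X (σ p)) {p : ℕ} (hp : p < q) (j : ℕ) :
    σ^[j] p < q ∧ f^[j] (X p) = X (σ^[j] p) := by
  induction j with
  | zero => exact ⟨hp, rfl⟩
  | succ j ih =>
    rw [Function.iterate_succ_apply', Function.iterate_succ_apply', ih.2]
    exact ⟨hσ _ ih.1, hf _ ih.1⟩

theorem minimalPeriod_eq_of_semiconj_lt {q : ℕ} {σ : ℕ → ℕ} {f : ℝ → ℝ} {X : ℕ → ℝ}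
    (hX : InjOn X (Iio q)) (hσ : ∀ p < q, σ p < q) (hf : ∀ p < q, f (X p) = X (σ p)) {p : ℕ}
    (hp : p < q) : Function.minimalPeriod f (X p) = Function.minimalPeriod σ p := by
  rw [Function.minimalPeriod_eq_minimalPeriod_iff]
  intro n
  have h := iterate_eq_of_semiconj_lt hσ hf hp n
  change f^[n] (X p) = X p ↔ σ^[n] p = p
  rw [h.2]
  exact hX.eq_iff h.1 hp

/-! ### Unimodality of next visiting permutations -/

namespace IsC2Unimodal

variable {f : ℝ → ℝ} {a b C : ℝ}

theorem strictMonoOn_Icc (hf : IsC2Unimodal f a b C) : StrictMonoOn f (Icc a C) := by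
  have hc : ContinuousWithinAt f (Ico a C) C :=
    (hf.contDiffOn.continuousOn C ⟨hf.left_lt.le, hf.lt_right.le⟩).mono
      (fun x hx => ⟨hx.1, hx.2.le.trans hf.lt_right.le⟩)
  have hcl : ClusterPt C (Filter.principal (Ico a C)) := by
    rw [← mem_closure_iff_clusterPt, closure_Ico hf.left_lt.ne]
    exact right_mem_Icc.2 hf.left_lt.le
  have hm := hf.strictMonoOn.monotoneOn.insert_of_continuousWithinAt hcl hc
  rw [Ico_insert_right hf.left_lt.le] at hm
  intro x hx y hy hxy
  have hxC : x < C := hxy.trans_le hy.2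
  obtain ⟨w, hxw, hwy⟩ := exists_between hxy
  exact (hf.strictMonoOn ⟨hx.1, hxC⟩ ⟨hx.1.trans hxw.le, hwy.trans_le hy.2⟩ hxw).trans_le
    (hm ⟨hx.1.trans hxw.le, hwy.le.trans hy.2⟩ hy hwy.le)

theorem strictAntiOn_Icc (hf : IsC2Unimodal f a b C) : StrictAntiOn f (Icc C b) := by
  have hc : ContinuousWithinAt f (Ioc C b) C :=
    (hf.contDiffOn.continuousOn C ⟨hf.left_lt.le, hf.lt_right.le⟩).mono
      (fun x hx => ⟨hf.left_lt.le.trans hx.1.le, hx.2⟩)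
  have hcl : ClusterPt C (Filter.principal (Ioc C b)) := by
    rw [← mem_closure_iff_clusterPt, closure_Ioc hf.lt_right.ne]
    exact left_mem_Icc.2 hf.lt_right.le
  have hm := hf.strictAntiOn.antitoneOn.neg.insert_of_continuousWithinAt hcl hc.neg
  rw [Ioc_insert_left hf.lt_right.le] at hm
  intro x hx y hy hxy
  have hCy : C < y := hx.1.trans_lt hxy
  obtain ⟨w, hxw, hwy⟩ := exists_between hxy
  exact (hf.strictAntiOn ⟨hx.1.trans_lt hxw, hwy.le.trans hy.2⟩ ⟨hCy, hy.2⟩ hwy).trans_le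
    (neg_le_neg_iff.1 (hm hx ⟨hx.1.trans hxw.le, hwy.le.trans hy.2⟩ hxw.le))

end IsC2Unimodal

namespace Supercycle

variable {q : ℕ} {O : Supercycle q} {X : ℕ → ℝ}

theorem C_mem_Icc (O : Supercycle q) : O.C ∈ Icc O.a O.b :=
  ⟨O.unimodal.left_lt.le, O.unimodal.lt_right.le⟩

theorem iterate_mem_Icc (O : Supercycle q) {x : ℝ} (hx : x ∈ Icc O.a O.b) (j : ℕ) :
    O.f^[j] x ∈ Icc O.a O.b :=
  (O.unimodal.mapsTo.iterate j) hx

theorem apply_lt_apply_C (O : Supercycle q) {x : ℝ} (hx : x ∈ Icc O.a O.b) (hne : x ≠ O.C) :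
    O.f x < O.f O.C := by
  rcases lt_or_gt_of_ne hne with h | h
  · exact O.unimodal.strictMonoOn_Icc ⟨hx.1, h.le⟩ ⟨O.C_mem_Icc.1, le_rfl⟩ h
  · exact O.unimodal.strictAntiOn_Icc ⟨le_rfl, O.C_mem_Icc.2⟩ ⟨h.le, hx.2⟩ h

theorem apply_le_apply_C (O : Supercycle q) {x : ℝ} (hx : x ∈ Icc O.a O.b) :
    O.f x ≤ O.f O.C := by
  rcases eq_or_ne x O.C with rfl | hne
  · exact le_rfl
  · exact (O.apply_lt_apply_C hx hne).le

theorem C_mem_points (O : Supercycle q) : O.C ∈ O.points :=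
  Finset.mem_image.2 ⟨0, Finset.mem_range.2 O.pos, rfl⟩

theorem le_apply_C (O : Supercycle q) {x : ℝ} (hx : x ∈ O.points) : x ≤ O.f O.C := by
  obtain ⟨j, -, rfl⟩ := Finset.mem_image.1 hx
  have hper := Function.isPeriodicPt_minimalPeriod O.f O.C
  rw [O.period] at hper
  -- `f^j C = f^(j + q) C` is a value of `f`, also for `j = 0`
  have h : O.f^[j] O.C = O.f (O.f^[j + (q - 1)] O.C) := by
    rw [← Function.iterate_succ_apply' O.f, Nat.succ_eq_add_one, Nat.add_assoc,
      Nat.sub_add_cancel O.pos, Function.iterate_add_apply, hper.eq]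
  rw [h]
  exact O.apply_le_apply_C (O.iterate_mem_Icc O.C_mem_Icc _)

theorem IsDescending.mem_points (hX : O.IsDescending X) {p : ℕ} (hp : p < q) :
    X p ∈ O.points := by
  rw [hX.2]
  exact Finset.mem_image_of_mem _ (Finset.mem_range.2 hp)

theorem IsDescending.mem_Icc (hX : O.IsDescending X) {p : ℕ} (hp : p < q) :
    X p ∈ Icc O.a O.b := by
  obtain ⟨j, -, hj⟩ := Finset.mem_image.1 (hX.mem_points hp)
  rw [← hj]
  exact O.iterate_mem_Icc O.C_mem_Icc j

theorem IsDescending.exists_eq_C (hX : O.IsDescending X) : ∃ c < q, X c = O.C := by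
  have h := O.C_mem_points
  rw [hX.2] at h
  obtain ⟨c, hc, hcC⟩ := Finset.mem_image.1 h
  exact ⟨c, Finset.mem_range.1 hc, hcC⟩

/-- A next visiting permutation is a unimodal cycle, with turning position that of the critical
point. -/
theorem IsDescending.isUnimodalCycle (hX : O.IsDescending X) {β : ℕ → ℕ}
    (hβ : O.IsNextVisitingPerm β) {z : ℕ} (hz : z < q) (hβz : β (z + 1) = 1) :
    X z = O.C ∧ IsUnimodalCycle q (fun p => β (p + 1) - 1) z := by
  have hmaps : ∀ p < q, β (p + 1) - 1 < q := fun p hp => (hX.apply hβ hp).2.1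
  have hf : ∀ p < q, O.f (X p) = X (β (p + 1) - 1) := fun p hp => (hX.apply hβ hp).2.2
  have hC : X z = O.C := by
    -- `f C` is the largest value, so a point sent to position `0` can only be `C`
    by_contra hne
    have h1 := O.apply_lt_apply_C (hX.mem_Icc hz) hne
    rw [hf z hz, hβz, Nat.sub_self] at h1
    obtain ⟨c, hc, hcC⟩ := hX.exists_eq_C
    rw [← hcC, hf c hc] at h1
    exact absurd ((hX.1.lt_iff_gt O.pos (hmaps c hc)).1 h1) (Nat.not_lt_zero _)
  refine ⟨hC, hz, hmaps, ?_, ?_, ?_⟩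
  · intro i hi j hj hij
    have hi : i ≤ z := hi
    have hj : j ≤ z := hj
    have hiq : i < q := by omega
    have hjq : j < q := by omega
    have hle : ∀ k ≤ z, O.C ≤ X k := fun k hk =>
      hC ▸ (hX.1.le_iff_ge hz (show k < q by omega)).2 hk
    have h := O.unimodal.strictAntiOn_Icc ⟨hle j hj, (hX.mem_Icc hjq).2⟩
      ⟨hle i hi, (hX.mem_Icc hiq).2⟩ (hX.1 hiq hjq hij)
    rw [hf i hiq, hf j hjq] at h
    exact (hX.1.lt_iff_gt (hmaps i hiq) (hmaps j hjq)).1 h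
  · intro i hi j hj hij
    have hle : ∀ k ∈ Ico z q, X k ≤ O.C := fun k hk => hC ▸ (hX.1.le_iff_ge hk.2 hz).2 hk.1
    have h := O.unimodal.strictMonoOn_Icc ⟨(hX.mem_Icc hj.2).1, hle j hj⟩
      ⟨(hX.mem_Icc hi.2).1, hle i hi⟩ (hX.1 hi.2 hj.2 hij)
    rw [hf i hi.2, hf j hj.2] at h
    exact (hX.1.lt_iff_gt (hmaps j hj.2) (hmaps i hi.2)).1 h
  · rw [← minimalPeriod_eq_of_semiconj_lt hX.1.injOn hmaps hf hz, hC, O.period]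

/-- A next visiting permutation permutes `{1, …, q}`. -/
theorem IsNextVisitingPerm.bijOn {β : ℕ → ℕ} (hβ : O.IsNextVisitingPerm β) :
    (∀ p < q, 1 ≤ β (p + 1) ∧ β (p + 1) ≤ q) ∧ ∀ v < q, ∃ p < q, β (p + 1) = v + 1 := by
  obtain ⟨X, hX⟩ := O.exists_isDescending
  obtain ⟨z, hz, hzC⟩ := hX.exists_eq_C
  obtain ⟨h1, h2, h3⟩ := hX.apply hβ hz
  have hβz : β (z + 1) = 1 := by
    have h := O.le_apply_C (hX.mem_points O.pos)
    rw [← hzC, h3] at h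
    have := (hX.1.le_iff_ge O.pos h2).1 h
    omega
  have hσ := (hX.isUnimodalCycle hβ hz hβz).2
  refine ⟨fun p hp => ?_, fun v hv => ?_⟩
  · have := hX.apply hβ hp
    omega
  · obtain ⟨p, hp, h⟩ := hσ.exists_preimage hv
    have := hX.apply hβ hp
    exact ⟨p, hp, by omega⟩

end Supercycle

/-! ### Realization of unimodal cycles -/

/-- Every unimodal cycle is the next visiting permutation of a supercycle: the interpolation of the
cycle on the integers `1, …, h`, extended by the value `0` at `0` and at `h + 1`. -/
theorem IsUnimodalCycle.exists_supercycle {h : ℕ} {τ : ℕ → ℕ} {c : ℕ}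
    (hτ : IsUnimodalCycle h τ c) :
    ∃ O : Supercycle h, O.IsNextVisitingPerm (fun i => τ (i - 1) + 1) := by
  have hc := hτ.lt
  -- position `p` sits at the integer `h - p`, so that positions are in descending order
  let y : ℕ → ℝ := fun n => if 1 ≤ n ∧ n ≤ h then ((h - τ (h - n) : ℕ) : ℝ) else 0
  have hlt : ∀ p, p < h → τ p < h := hτ.mapsTo
  have hyp : ∀ n, 1 ≤ n → n ≤ h → y n = ((h - τ (h - n) : ℕ) : ℝ) :=
    fun n h1 h2 => if_pos ⟨h1, h2⟩
  have hy0 : y 0 = 0 := if_neg (by omega)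
  have hyh : y (h + 1) = 0 := if_neg (by omega)
  have hup : ∀ n < h - c, y n < y (n + 1) := by
    intro n hn
    rw [hyp (n + 1) (by omega) (by omega)]
    rcases Nat.eq_zero_or_pos n with rfl | hn0
    · have := hlt (h - (0 + 1)) (by omega)
      rw [hy0, Nat.cast_pos]
      omega
    · have h1 := hτ.mono (show h - (n + 1) ∈ Ico c h by constructor <;> omega)
        (show h - n ∈ Ico c h by constructor <;> omega) (by omega)
      have h2 := hlt (h - n) (by omega)
      rw [hyp n hn0 (by omega), Nat.cast_lt]
      omega
  have hdown : ∀ n, h - c ≤ n → n < h + 1 → y (n + 1) < y n := by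
    intro n hn hn'
    have h2 := hlt (h - n) (by omega)
    rw [hyp n (by omega) (by omega)]
    rcases Nat.lt_or_ge n h with hnh | hnh
    · have h1 := hτ.anti (show h - (n + 1) ∈ Iic c by rw [mem_Iic]; omega)
        (show h - n ∈ Iic c by rw [mem_Iic]; omega) (by omega)
      rw [hyp (n + 1) (by omega) (by omega), Nat.cast_lt]
      omega
    · obtain rfl : n = h := by omega
      rw [hyh, Nat.cast_pos]
      omega
  let g := smoothInterp (h + 1) y
  have hmono : StrictMonoOn g (Icc 0 ((h - c : ℕ) : ℝ)) :=
    strictMonoOn_smoothInterp (by omega) hup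
  have hanti : StrictAntiOn g (Icc ((h - c : ℕ) : ℝ) ((h + 1 : ℕ) : ℝ)) :=
    strictAntiOn_smoothInterp hdown
  have hC0 : (0 : ℝ) < ((h - c : ℕ) : ℝ) := Nat.cast_pos.2 (by omega)
  have hCh : ((h - c : ℕ) : ℝ) < ((h + 1 : ℕ) : ℝ) := Nat.cast_lt.2 (by omega)
  have hg0 : g 0 = 0 := by
    have := smoothInterp_natCast (N := h + 1) y (Nat.zero_le _)
    rwa [Nat.cast_zero, hy0] at this
  have hgh : g ((h + 1 : ℕ) : ℝ) = 0 := by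
    rw [← hyh]
    exact smoothInterp_natCast y le_rfl
  have hgC : g ((h - c : ℕ) : ℝ) ≤ ((h + 1 : ℕ) : ℝ) := by
    have := smoothInterp_natCast (N := h + 1) y (show h - c ≤ h + 1 by omega)
    change smoothInterp (h + 1) y _ ≤ _
    rw [this, hyp _ (by omega) (by omega), Nat.cast_le]
    omega
  have hmaps : MapsTo g (Icc 0 ((h + 1 : ℕ) : ℝ)) (Icc 0 ((h + 1 : ℕ) : ℝ)) := by
    intro x hx
    rcases le_total x ((h - c : ℕ) : ℝ) with hxC | hxC
    · constructor
      · rw [← hg0]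
        exact hmono.monotoneOn ⟨le_rfl, hC0.le⟩ ⟨hx.1, hxC⟩ hx.1
      · exact (hmono.monotoneOn ⟨hx.1, hxC⟩ ⟨hC0.le, le_rfl⟩ hxC).trans hgC
    · constructor
      · rw [← hgh]
        exact hanti.antitoneOn ⟨hxC, hx.2⟩ ⟨hCh.le, le_rfl⟩ hx.2
      · exact (hanti.antitoneOn ⟨le_rfl, hCh.le⟩ ⟨hxC, hx.2⟩ hxC).trans hgC
  let X : ℕ → ℝ := fun p => ((h - p : ℕ) : ℝ)
  have hX : StrictAntiOn X (Iio h) := by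
    intro i hi j hj hij
    have hi : i < h := hi
    exact Nat.cast_lt.2 (by omega)
  have hgX : ∀ p < h, g (X p) = X (τ p) := by
    intro p hp
    have := smoothInterp_natCast (N := h + 1) y (show h - p ≤ h + 1 by omega)
    change smoothInterp (h + 1) y _ = _
    rw [this, hyp _ (by omega) (by omega), show h - (h - p) = p by omega]
  let O : Supercycle h :=
    { f := g
      a := 0
      b := ((h + 1 : ℕ) : ℝ)
      C := X c
      unimodal :=
        { left_lt := hC0
          lt_right := hCh
          mapsTo := hmaps
          contDiffOn := (contDiff_smoothInterp _ _).contDiffOn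
          strictMonoOn := hmono.mono Ico_subset_Icc_self
          strictAntiOn := hanti.mono Ioc_subset_Icc_self }
      pos := by omega
      period := by rw [minimalPeriod_eq_of_semiconj_lt hX.injOn hτ.mapsTo hgX hc, hτ.period] }
  have hdesc : O.IsDescending X := by
    refine ⟨hX, ?_⟩
    ext x
    simp only [Supercycle.points, Finset.mem_image, Finset.mem_range]
    constructor
    · rintro ⟨j, -, rfl⟩
      obtain ⟨h1, h2⟩ := iterate_eq_of_semiconj_lt hτ.mapsTo hgX hc j
      exact ⟨_, h1, h2.symm⟩
    · rintro ⟨p, hp, rfl⟩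
      obtain ⟨j, hj, rfl⟩ := hτ.exists_iterate hp
      exact ⟨j, hj, (iterate_eq_of_semiconj_lt hτ.mapsTo hgX hc j).2⟩
  exact ⟨O, hdesc.isNextVisitingPerm hτ.mapsTo hgX⟩

/-! ### The extremum of the first return map -/

section LocalExtremum

open Filter Topology

namespace Supercycle

variable {h s z : ℕ} {σ τ : ℕ → ℕ} {O : Supercycle (h * s)} {X : ℕ → ℝ}

theorem tendsto_iterate {q : ℕ} (O : Supercycle q) (j : ℕ) :
    Tendsto O.f^[j] (𝓝[≠] O.C) (𝓝[Icc O.a O.b] (O.f^[j] O.C)) := by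
  have hnhds : Icc O.a O.b ∈ 𝓝 O.C := Icc_mem_nhds O.unimodal.left_lt O.unimodal.lt_right
  induction j with
  | zero =>
    change Tendsto id (𝓝[≠] O.C) (𝓝[Icc O.a O.b] O.C)
    rw [nhdsWithin_eq_nhds.2 hnhds]
    exact tendsto_id.mono_left nhdsWithin_le_nhds
  | succ j ih =>
    rw [Function.iterate_succ']
    exact ((O.unimodal.contDiffOn.continuousOn _
      (O.iterate_mem_Icc O.C_mem_Icc j)).tendsto_nhdsWithin O.unimodal.mapsTo).comp ih

/-- The critical point is a strict local maximum or minimum of the first return map to its box,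
according to the parity of the number `z / s` of boxes on which `f` reverses the order. -/
theorem IsDescending.eventually_first_return (hX : O.IsDescending X)
    (hσ : IsUnimodalCycle (h * s) σ z) (hf : ∀ p < h * s, O.f (X p) = X (σ p)) (hz : X z = O.C)
    (hb : MapsBoxes h s σ τ) :
    ∀ᶠ x in 𝓝[≠] O.C, if Even (z / s) then O.f^[h] x < O.f^[h] O.C
      else O.f^[h] O.C < O.f^[h] x := by
  have hτ := hb.isUnimodalCycle hσ
  have hh : 0 < h := Nat.zero_lt_of_lt hτ.lt
  have key : ∀ j < h, ∀ᶠ x in 𝓝[≠] O.C, if Even (reversals τ (z / s) j)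
      then O.f^[j + 1] x < O.f^[j + 1] O.C else O.f^[j + 1] O.C < O.f^[j + 1] x := by
    intro j
    induction j with
    | zero =>
      intro _
      filter_upwards [self_mem_nhdsWithin, mem_nhdsWithin_of_mem_nhds
        (Icc_mem_nhds O.unimodal.left_lt O.unimodal.lt_right)] with x hne hx
      rw [reversals_zero, if_pos Even.zero]
      exact O.apply_lt_apply_C hx hne
    | succ j ih =>
      intro hj
      obtain ⟨hpq, hpX⟩ := iterate_eq_of_semiconj_lt hσ.mapsTo hf hσ.lt (j + 1)
      rw [hz] at hpX
      have hdiv := hb.iterate_div hσ hσ.lt (j + 1)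
      have hmem := O.iterate_mem_Icc O.C_mem_Icc (j + 1)
      have htend := O.tendsto_iterate (j + 1)
      have hIcc : ∀ᶠ x in 𝓝[≠] O.C, O.f^[j + 1] x ∈ Icc O.a O.b :=
        htend self_mem_nhdsWithin
      have htend' := htend.mono_right nhdsWithin_le_nhds
      simp only [Function.iterate_succ_apply' O.f (j + 1), reversals_succ]
      rcases lt_or_gt_of_ne (hτ.iterate_ne hj) with hc | hc
      · -- `f^(j + 1) C` lies in a box to the left of the turning box, that is, above `C`
        have hlt : O.C < O.f^[j + 1] O.C := by
          rw [hpX, ← hz, hX.1.lt_iff_gt hσ.lt hpq]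
          rw [← hdiv] at hc
          exact lt_of_not_ge fun hle => hc.not_ge (Nat.div_le_div_right hle)
        filter_upwards [ih (by omega), hIcc, htend'.eventually (lt_mem_nhds hlt)] with x h1 h2 h3
        rw [if_pos hc]
        simp only [Nat.even_add_one]
        by_cases hev : Even (reversals τ (z / s) j)
        · rw [if_pos hev] at h1
          rw [if_neg (not_not.2 hev)]
          exact O.unimodal.strictAntiOn_Icc ⟨h3.le, h2.2⟩ ⟨hlt.le, hmem.2⟩ h1
        · rw [if_neg hev] at h1
          rw [if_pos hev]
          exact O.unimodal.strictAntiOn_Icc ⟨hlt.le, hmem.2⟩ ⟨h3.le, h2.2⟩ h1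
      · have hlt : O.f^[j + 1] O.C < O.C := by
          rw [hpX, ← hz, hX.1.lt_iff_gt hpq hσ.lt]
          rw [← hdiv] at hc
          exact lt_of_not_ge fun hle => hc.not_ge (Nat.div_le_div_right hle)
        filter_upwards [ih (by omega), hIcc, htend'.eventually (gt_mem_nhds hlt)] with x h1 h2 h3
        rw [if_neg hc.not_gt]
        simp only [Nat.add_zero]
        by_cases hev : Even (reversals τ (z / s) j)
        · rw [if_pos hev] at h1 ⊢
          exact O.unimodal.strictMonoOn_Icc ⟨h2.1, h3.le⟩ ⟨hmem.1, hlt.le⟩ h1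
        · rw [if_neg hev] at h1 ⊢
          exact O.unimodal.strictMonoOn_Icc ⟨hmem.1, hlt.le⟩ ⟨h2.1, h3.le⟩ h1
  have := key (h - 1) (by omega)
  rwa [hτ.reversals_eq, Nat.sub_add_cancel hh] at this

end Supercycle

theorem isLocalMax_of_eventually_lt {g : ℝ → ℝ} {x₀ : ℝ} (hg : ∀ᶠ x in 𝓝[≠] x₀, g x < g x₀) :
    IsLocalMax g x₀ ∧ ¬ IsLocalMin g x₀ := by
  constructor
  · filter_upwards [eventually_nhdsWithin_iff.1 hg] with x hx
    rcases eq_or_ne x x₀ with rfl | hne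
    · exact le_rfl
    · exact (hx hne).le
  · intro hmin
    obtain ⟨x, h1, h2⟩ := (hg.and (hmin.filter_mono nhdsWithin_le_nhds)).exists
    exact absurd h1 (not_lt.2 h2)

theorem isLocalMin_of_eventually_gt {g : ℝ → ℝ} {x₀ : ℝ} (hg : ∀ᶠ x in 𝓝[≠] x₀, g x₀ < g x) :
    IsLocalMin g x₀ ∧ ¬ IsLocalMax g x₀ := by
  have h := isLocalMax_of_eventually_lt (g := fun x => -g x) (hg.mono fun x hx => neg_lt_neg hx)
  refine ⟨by simpa using h.1.neg, fun hmax => h.2 hmax.neg⟩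

end LocalExtremum

/-! ### Decomposition of a supercycle -/

theorem mem_box_succ {s i p : ℕ} : p ∈ box s (i + 1) ↔ ∃ k < s, p = i * s + k + 1 := by
  simp only [box, Finset.mem_image, Finset.mem_Icc, Nat.add_sub_cancel]
  constructor
  · rintro ⟨k, hk, rfl⟩
    exact ⟨k - 1, by omega, by omega⟩
  · rintro ⟨k, hk, rfl⟩
    exact ⟨k + 1, by omega, by omega⟩

/-- The block conditions say that each box but the turning one is mapped onto a run of consecutive
positions, and the turning box onto the first box; they force all the runs to be boxes. -/
theorem mapsBoxes_of_blockEntry {h s z : ℕ} {β βs : ℕ → ℕ} {Os : Supercycle s}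
    (hσ : IsUnimodalCycle (h * s) (fun p => β (p + 1) - 1) z)
    (hblock : ∀ i < h, ∀ k < s, blockEntry s β (i + 1) (k + 1) = β (i * s + k + 1) - 1 + 1)
    (hβs : Os.IsNextVisitingPerm βs)
    (H : ∀ k ∈ Finset.Icc 1 s,
      (∀ i ∈ Finset.Icc 1 (z / s),
        (blockEntry s β i k : ℤ) = (blockEntry s β i 1 : ℤ) - ((k : ℤ) - 1)) ∧
      (∀ i ∈ Finset.Icc (z / s + 2) h,
        (blockEntry s β i k : ℤ) = (blockEntry s β i 1 : ℤ) + ((k : ℤ) - 1)) ∧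
      (Odd (z / s + 1) → blockEntry s β (z / s + 1) k = βs k) ∧
      (Even (z / s + 1) → blockEntry s β (z / s + 1) k = βs (s + 1 - k))) :
    ∃ τ, MapsBoxes h s (fun p => β (p + 1) - 1) τ := by
  have hz := hσ.lt
  have hs : 0 < s := Os.pos
  have hm : z / s < h := Nat.div_lt_of_lt_mul (by rwa [Nat.mul_comm])
  obtain ⟨hβ1, hβ2⟩ := hβs.bijOn
  have hleft : ∀ i < z / s, ∀ k < s,
      β (i * s + k + 1) - 1 + k = β (i * s + 0 + 1) - 1 := by
    intro i hi k hk
    have h1 := (H (k + 1) (Finset.mem_Icc.2 ⟨by omega, by omega⟩)).1 (i + 1)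
      (Finset.mem_Icc.2 ⟨by omega, by omega⟩)
    have h3 := hblock i (by omega) 0 hs
    rw [Nat.zero_add] at h3
    rw [hblock i (by omega) k hk, h3] at h1
    push_cast at h1
    omega
  have hright : ∀ i, z / s < i → i < h → ∀ k < s,
      β (i * s + k + 1) - 1 = β (i * s + 0 + 1) - 1 + k := by
    intro i hi hih k hk
    have h1 := (H (k + 1) (Finset.mem_Icc.2 ⟨by omega, by omega⟩)).2.1 (i + 1)
      (Finset.mem_Icc.2 ⟨by omega, by omega⟩)
    have h3 := hblock i (by omega) 0 hs
    rw [Nat.zero_add] at h3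
    rw [hblock i (by omega) k hk, h3] at h1
    push_cast at h1
    omega
  let r : ℕ → ℕ := fun i =>
    if i < z / s then β (i * s + (s - 1) + 1) - 1 else if i = z / s then 0 else β (i * s + 0 + 1) - 1
  refine ⟨_, mapsBoxes_of_runs (r := r) hσ fun i hi v => ?_⟩
  rcases lt_trichotomy i (z / s) with hc | hc | hc
  · have hri : r i = β (i * s + (s - 1) + 1) - 1 := if_pos hc
    have hlast := hleft i hc (s - 1) (by omega)
    rw [hri]
    constructor
    · rintro ⟨k, hk, rfl⟩
      have := hleft i hc k hk
      omega
    · intro hv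
      have := hleft i hc (β (i * s + 0 + 1) - 1 - v) (by omega)
      exact ⟨β (i * s + 0 + 1) - 1 - v, by omega, by omega⟩
  · have hri : r i = 0 := by simp [r, hc]
    rw [hri, hc]
    rcases Nat.even_or_odd (z / s) with hev | hodd
    · have hval : ∀ k < s, β (z / s * s + k + 1) - 1 + 1 = βs (k + 1) := by
        intro k hk
        rw [← hblock _ hm k hk]
        exact (H (k + 1) (Finset.mem_Icc.2 ⟨by omega, by omega⟩)).2.2.1 hev.add_one
      constructor
      · rintro ⟨k, hk, rfl⟩
        have h1 := hval k hk
        have h2 := hβ1 k hk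
        omega
      · intro hv
        obtain ⟨k, hk, hkv⟩ := hβ2 v (by omega)
        have h1 := hval k hk
        exact ⟨k, hk, by omega⟩
    · have hval : ∀ k < s, β (z / s * s + k + 1) - 1 + 1 = βs (s - 1 - k + 1) := by
        intro k hk
        rw [← hblock _ hm k hk, show s - 1 - k + 1 = s + 1 - (k + 1) by omega]
        exact (H (k + 1) (Finset.mem_Icc.2 ⟨by omega, by omega⟩)).2.2.2 hodd.add_one
      constructor
      · rintro ⟨k, hk, rfl⟩
        have h1 := hval k hk
        have h2 := hβ1 (s - 1 - k) (by omega)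
        omega
      · intro hv
        obtain ⟨k, hk, hkv⟩ := hβ2 v (by omega)
        have h1 := hval (s - 1 - k) (by omega)
        rw [show s - 1 - (s - 1 - k) = k by omega] at h1
        exact ⟨s - 1 - k, by omega, by omega⟩
  · have hri : r i = β (i * s + 0 + 1) - 1 := by
      simp only [r]
      rw [if_neg hc.not_gt, if_neg hc.ne']
    rw [hri]
    constructor
    · rintro ⟨k, hk, rfl⟩
      have := hright i hc hi k hk
      omega
    · intro hv
      have := hright i hc hi (v - (β (i * s + 0 + 1) - 1)) (by omega)
      exact ⟨v - (β (i * s + 0 + 1) - 1), by omega, by omega⟩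

theorem theorem2 (q h s : ℕ) (hq : q = h * s) (O : Supercycle q)
    (β : ℕ → ℕ) (hβ : O.IsNextVisitingPerm β)
    (z : ℕ) (hz : z ∈ Finset.Icc 1 q) (hβz : β z = 1) :
    (∃ (Oh : Supercycle h) (Os : Supercycle s), IsComposition O Oh Os) ↔
    (∃ (Os : Supercycle s) (βs : ℕ → ℕ), Os.IsNextVisitingPerm βs ∧
      ∀ k ∈ Finset.Icc 1 s,
        (∀ i ∈ Finset.Icc 1 ((z - 1) / s),
          (blockEntry s β i k : ℤ) = (blockEntry s β i 1 : ℤ) - ((k : ℤ) - 1)) ∧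
        (∀ i ∈ Finset.Icc ((z - 1) / s + 2) h,
          (blockEntry s β i k : ℤ) = (blockEntry s β i 1 : ℤ) + ((k : ℤ) - 1)) ∧
        (Odd ((z - 1) / s + 1) → blockEntry s β ((z - 1) / s + 1) k = βs k) ∧
        (Even ((z - 1) / s + 1) → blockEntry s β ((z - 1) / s + 1) k = βs (s + 1 - k))) := by
  subst hq
  obtain ⟨z, rfl⟩ : ∃ z', z = z' + 1 := ⟨z - 1, by have := (Finset.mem_Icc.1 hz).1; omega⟩
  have hz : z < h * s := (Finset.mem_Icc.1 hz).2
  rw [Nat.add_sub_cancel]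
  have hs : 0 < s := Nat.pos_of_ne_zero (by rintro rfl; simp at hz)
  obtain ⟨X, hX⟩ := O.exists_isDescending
  obtain ⟨hzC, hσ⟩ := hX.isUnimodalCycle hβ hz hβz
  have hf : ∀ p < h * s, O.f (X p) = X (β (p + 1) - 1) := fun p hp => (hX.apply hβ hp).2.2
  have hblock : ∀ i < h, ∀ k < s,
      blockEntry s β (i + 1) (k + 1) = β (i * s + k + 1) - 1 + 1 := by
    intro i hi k hk
    rw [← (hX.apply hβ (mul_add_lt_mul hi hk)).1, blockEntry, Nat.add_sub_cancel, Nat.add_assoc]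
  have hm : z / s < h := Nat.div_lt_of_lt_mul (by rwa [Nat.mul_comm])
  have hreturn : ∀ k < s, O.f^[h] (X (z / s * s + k)) =
      X ((fun p => β (p + 1) - 1)^[h] (z / s * s + k)) := fun k hk =>
    (iterate_eq_of_semiconj_lt hσ.mapsTo hf (mul_add_lt_mul hm hk) h).2
  constructor
  · rintro ⟨Oh, Os, -, βh, βs, hβh, hβs, hbox, hcen⟩
    have hb : MapsBoxes h s (fun p => β (p + 1) - 1) (fun i => βh (i + 1) - 1) := by
      intro p hp
      have hph : p / s < h := Nat.div_lt_of_lt_mul (by rwa [Nat.mul_comm])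
      have hpp : p = p / s * s + p % s := by rw [Nat.mul_comm, Nat.div_add_mod]
      obtain ⟨p', hp', hord⟩ := hbox (p / s + 1) (Finset.mem_Icc.2 ⟨Nat.le_add_left 1 _, hph⟩) (p + 1)
        (mem_box_succ.2 ⟨p % s, Nat.mod_lt _ hs, by omega⟩) _ (hX.isOrdPoint hp)
      have h1 := hβh.bijOn.1 _ hph
      rw [show βh (p / s + 1) = βh (p / s + 1) - 1 + 1 by omega] at hp'
      obtain ⟨k, hk, rfl⟩ := mem_box_succ.1 hp'
      have h2 := hord.2.symm.trans (hβ _ _ (hX.isOrdPoint hp)).2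
      dsimp only
      rw [← h2, Nat.add_sub_cancel, mul_add_div hk]
    have hτ := hb.isUnimodalCycle hσ
    have hcen := hcen (z / s + 1) (Finset.mem_Icc.2 ⟨Nat.le_add_left 1 _, hm⟩) (by
      have h1 := hτ.apply_top
      have h2 := hβh.bijOn.1 _ hm
      omega)
    rw [Nat.add_sub_cancel] at hcen
    have hext := hX.eventually_first_return hσ hf hzC hb
    refine ⟨Os, βs, hβs, fun k hk => ?_⟩
    obtain ⟨k, rfl⟩ : ∃ k', k = k' + 1 := ⟨k - 1, by have := (Finset.mem_Icc.1 hk).1; omega⟩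
    have hk' : k < s := (Finset.mem_Icc.1 hk).2
    have hord := hX.isOrdPoint (mul_add_lt_mul hm hk')
    obtain ⟨hw, hret⟩ := hb.first_return hσ hk'
    have hord' := hX.isOrdPoint (hσ.iterate_lt (mul_add_lt_mul hm hk') h)
    rw [← hreturn k hk'] at hord'
    refine ⟨fun i hi => ?_, fun i hi => ?_, fun hodd => ?_, fun heven => ?_⟩
    · obtain ⟨i, rfl⟩ : ∃ i', i = i' + 1 := ⟨i - 1, by have := (Finset.mem_Icc.1 hi).1; omega⟩
      have hi : i < z / s := (Finset.mem_Icc.1 hi).2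
      have h1 := hb.apply_of_lt hσ hi hk'
      have h2 := hb.apply_of_lt hσ hi hs
      have h3 := hblock i (by omega) 0 hs
      rw [Nat.zero_add] at h3
      rw [hblock i (by omega) k hk', h3]
      rw [h1, h2]
      push_cast
      omega
    · have h2 := (Nat.le_add_left 2 _).trans (Finset.mem_Icc.1 hi).1
      obtain ⟨i, rfl⟩ : ∃ i', i = i' + 1 := ⟨i - 1, by omega⟩
      obtain ⟨hi, hih⟩ := Finset.mem_Icc.1 hi
      have hi : z / s < i := by omega
      have h1 := hb.apply_of_gt hσ hi hih hk'
      have h2 := hb.apply_of_gt hσ hi hih hs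
      have h3 := hblock i (by omega) 0 hs
      rw [Nat.zero_add] at h3
      rw [hblock i (by omega) k hk', h3]
      rw [h1, h2]
      push_cast
      omega
    · have hev : Even (z / s) := by
        by_contra hne
        exact Nat.not_even_iff_odd.2 hodd (Nat.not_even_iff_odd.1 hne).add_one
      simp only [if_pos hev] at hext hret
      have h1 := hcen.1 (isLocalMax_of_eventually_lt hext).1 (k + 1) hk _ hord
      have h2 := h1.2.symm.trans hord'.2
      rw [hblock _ hm k hk']
      omega
    · have hev : ¬ Even (z / s) := fun hev => Nat.not_even_iff_odd.2 hev.add_one heven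
      simp only [if_neg hev] at hext hret
      have h1 := hcen.2 (isLocalMin_of_eventually_gt hext).1 (k + 1) hk _ hord
      have h2 := h1.2.symm.trans hord'.2
      have h3 := hβs.bijOn.1 (s - 1 - k) (by omega)
      rw [show s - 1 - k + 1 = s + 1 - (k + 1) by omega] at h3
      rw [hblock _ hm k hk']
      unfold conjPerm at h2
      omega
  · rintro ⟨Os, βs, hβs, H⟩
    obtain ⟨τ, hb⟩ := mapsBoxes_of_blockEntry hσ hblock hβs H
    have hτ := hb.isUnimodalCycle hσ
    obtain ⟨Oh, hβh⟩ := hτ.exists_supercycle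
    have hext := hX.eventually_first_return hσ hf hzC hb
    refine ⟨Oh, Os, rfl, _, βs, hβh, hβs, ?_, ?_⟩
    · intro i hi p hp x hx
      obtain ⟨i, rfl⟩ : ∃ i', i = i' + 1 := ⟨i - 1, by have := (Finset.mem_Icc.1 hi).1; omega⟩
      have hi : i < h := (Finset.mem_Icc.1 hi).2
      obtain ⟨k, hk, rfl⟩ := mem_box_succ.1 hp
      refine ⟨_, ?_, hβ _ _ hx⟩
      obtain ⟨h1, h2⟩ := hb.apply_sub_lt hi hk
      refine mem_box_succ.2 ⟨_, h2, ?_⟩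
      rw [Nat.add_sub_cancel]
      rw [← h1]
      exact (hX.apply hβ (mul_add_lt_mul hi hk)).1
    · intro c hc hc1
      obtain ⟨c, rfl⟩ : ∃ c', c = c' + 1 := ⟨c - 1, by have := (Finset.mem_Icc.1 hc).1; omega⟩
      obtain rfl : c = z / s := by
        apply hτ.injOn (show c < h from (Finset.mem_Icc.1 hc).2) hm
        rw [hτ.apply_top]
        simpa using hc1
      have hpoint : ∀ k < s, ∀ x, O.IsOrdPoint (z / s * s + (k + 1)) x →
          O.IsOrdPoint ((fun p => β (p + 1) - 1)^[h] (z / s * s + k) + 1) (O.f^[h] x) := by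
        intro k hk x hx
        obtain ⟨p, hp, h1, rfl⟩ := hX.isOrdPoint_iff.1 hx
        obtain rfl : p = z / s * s + k := by omega
        rw [hreturn k hk]
        exact hX.isOrdPoint (hσ.iterate_lt hp h)
      rw [Nat.add_sub_cancel]
      by_cases hev : Even (z / s)
      · simp only [if_pos hev] at hext
        obtain ⟨-, hmin⟩ := isLocalMax_of_eventually_lt hext
        refine ⟨fun _ k hk x hx => ?_, fun hmin' => absurd hmin' hmin⟩
        obtain ⟨k, rfl⟩ : ∃ k', k = k' + 1 := ⟨k - 1, by have := (Finset.mem_Icc.1 hk).1; omega⟩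
        have hk' : k < s := (Finset.mem_Icc.1 hk).2
        have h1 := hpoint k hk' x hx
        rw [(hb.first_return hσ hk').2, if_pos hev, Nat.add_assoc] at h1
        rwa [← (H (k + 1) hk).2.2.1 hev.add_one, hblock _ hm k hk']
      · simp only [if_neg hev] at hext
        obtain ⟨-, hmax⟩ := isLocalMin_of_eventually_gt hext
        refine ⟨fun hmax' => absurd hmax' hmax, fun _ k hk x hx => ?_⟩
        obtain ⟨k, rfl⟩ : ∃ k', k = k' + 1 := ⟨k - 1, by have := (Finset.mem_Icc.1 hk).1; omega⟩
        have hk' : k < s := (Finset.mem_Icc.1 hk).2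
        have h1 := hpoint k hk' x hx
        obtain ⟨hw, hret⟩ := hb.first_return hσ hk'
        rw [hret, if_neg hev, Nat.add_assoc] at h1
        unfold conjPerm
        rw [← (H (k + 1) hk).2.2.2 (Nat.not_even_iff_odd.1 hev).add_one, hblock _ hm k hk']
        rwa [show s + 1 - (β (z / s * s + k + 1) - 1 + 1)
          = s - 1 - (β (z / s * s + k + 1) - 1) + 1 by omega]
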